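/- \textbf{Theorem.} Let $\mathcal H$ be a (real or complex) Hilbert space with $3\le\dim\mathcal H<\infty$, and let $L=L(\mathcal H)$ be the lattice of its closed subspaces, with meet $\wedge$ (intersection), join $\vee$ (closed span), orthogonal complement $p\mapsto p^\perp$, least element $\bot=\{0\}$ and greatest element $\top=\mathcal H$. For $p,q\in L$ put $p\mathbin{\&}q=q\wedge(p\vee q^\perp)$ (the Sasaki projection). Let $A$ be a set and $M\subseteq A\times L\times A$ a relation. Say that $a\in A$ \emph{verifies} $p\in L$, written $a\Vdash p$, if there is no $b\in A$ with $M(a,p^\perp,b)$. Suppose that $\mathfrak G=(A,M)$ is a model of $\mathcal T_{L(\mathcal H)}$, that is: \begin{enumerate} \item for all $a\in A$: $a\Vdash\top$; \item for all $a\in A$: not $a\Vdash\bot$; \item for every $p\in L$ with $p\ne\top$ there is $a\in A$ such that not $a\Vdash p$; \item for all $p,q\in L$ with $p\le q$ and all $a\in A$: $a\Vdash p$ implies $a\Vdash q$; \item for all $p,q\in L$ and $a\in A$: $a\Vdash p$ and $a\Vdash q$ imply $a\Vdash p\mathbin{\&}q$; \item for all $p,q\in L$ and $a,b\in A$: $a\Vdash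 p$ and $M(a,q,b)$ imply $b\Vdash p\mathbin{\&}q$. \end{enumerate} Then for every $a\in A$ there is an element $e(a)\in L(\mathcal H)$ which is the least element of $\{p\in L(\mathcal H): a\Vdash p\}$, and $$\{p\in L(\mathcal H): a\Vdash p\}=\{p\in L(\mathcal H): e(a)\le p\}.$$ Consequently, for all $p,q\in L(\mathcal H)$ and all $a\in A$, if $a\Vdash p$ and $a\Vdash q$, then $a\Vdash p\wedge q$. -/

import Mathlib

namespace QuantumMeasurement

/-- An orthomodular lattice: a bounded lattice with an order-reversing involution `ortho`, which
is a complementation, satisfying the orthomodular law. -/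
class Orthomodular (L : Type*) [Lattice L] [BoundedOrder L] where
  ortho : L → L
  ortho_ortho : ∀ p : L, ortho (ortho p) = p
  ortho_le_ortho : ∀ p q : L, p ≤ q → ortho q ≤ ortho p
  inf_ortho : ∀ p : L, p ⊓ ortho p = ⊥
  sup_ortho : ∀ p : L, p ⊔ ortho p = ⊤
  orthomodular_law : ∀ p q : L, p ≤ q → q = p ⊔ (q ⊓ ortho p)

/-- The Hilbert lattice `L(H)`: the closed subspaces of a Hilbert space `H`, ordered by inclusion
(meet: intersection, join: closed span), with the orthogonal complement. -/
noncomputable instance hilbertLattice {𝕜 H : Type*} [RCLike 𝕜] [NormedAddCommGroup H]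
    [InnerProductSpace 𝕜 H] [CompleteSpace H] : Orthomodular (ClosedSubmodule 𝕜 H) where
  ortho p := p.orthogonal
  ortho_ortho p := ClosedSubmodule.orthogonal_orthogonal_eq p
  ortho_le_ortho _ _ h := ClosedSubmodule.orthogonal_le h
  inf_ortho p := by
    apply ClosedSubmodule.toSubmodule_injective
    exact p.toSubmodule.inf_orthogonal_eq_bot
  sup_ortho p := by
    refine top_le_iff.mp fun x _ => subset_closure ?_
    have h := Submodule.sup_orthogonal_of_hasOrthogonalProjection (K := p.toSubmodule)
    have hx : x ∈ p.toSubmodule ⊔ p.toSubmodule.orthogonal := h ▸ Submodule.mem_top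
    exact hx
  orthomodular_law p q h := by
    refine le_antisymm (fun x hx => subset_closure ?_) (sup_le h inf_le_left)
    have hs := Submodule.sup_orthogonal_inf_of_hasOrthogonalProjection
      (K₁ := p.toSubmodule) (K₂ := q.toSubmodule) h
    have hx' : x ∈ p.toSubmodule ⊔ (p.toSubmodule.orthogonal ⊓ q.toSubmodule) := by
      rw [hs]; exact hx
    rw [inf_comm] at hx'
    exact hx'

/-- The Sasaki projection `p & q = q ∧ (p ∨ q⊥)`. -/
def sasaki {L : Type*} [Lattice L] [BoundedOrder L] [Orthomodular L] (p q : L) : L :=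
  q ⊓ (p ⊔ Orthomodular.ortho q)

/-- A graph with vertex set (universe) `A` and arrows labelled by `L`. Here `Mes a p b` means
that measuring the system `a` can yield the outcome `p` and leave the system `b`. -/
structure MeasurementGraph (L A : Type*) where
  Mes : A → L → A → Prop

namespace MeasurementGraph

variable {L A : Type*} [Lattice L] [BoundedOrder L] [Orthomodular L]

/-- `a` verifies `p` if the outcome `p⊥` is impossible at `a`. -/
def Verifies (G : MeasurementGraph L A) (a : A) (p : L) : Prop :=
  ¬ ∃ b, G.Mes a (Orthomodular.ortho p) b

/-- The set of properties verified by `a`. -/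
def verified (G : MeasurementGraph L A) (a : A) : Set L :=
  {p | G.Verifies a p}

/-- `G` is a model of the theory `T_L`, that is, it satisfies all its axioms. -/
structure IsModel (G : MeasurementGraph L A) : Prop where
  verifies_top : ∀ a, G.Verifies a ⊤
  not_verifies_bot : ∀ a, ¬ G.Verifies a ⊥
  exists_not_verifies : ∀ p : L, p ≠ ⊤ → ∃ a, ¬ G.Verifies a p
  verifies_of_le : ∀ p q : L, p ≤ q → ∀ a, G.Verifies a p → G.Verifies a q
  verifies_sasaki : ∀ p q : L, ∀ a, G.Verifies a p → G.Verifies a q → G.Verifies a (sasaki p q)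
  compatible_preservation : ∀ p q : L, ∀ a b,
    G.Verifies a p → G.Mes a q b → G.Verifies b (sasaki p q)

end MeasurementGraph

end QuantumMeasurement

open scoped InnerProductSpace

namespace QuantumMeasurement

/-! Finite dimension gives a minimal verified `p`. If a verified `r` is not above it, some `z ⊥ r`
has a nonzero component `x` in `p`. Measuring the plane of `x` and `z` leads to a system `b`
verifying both the line of `x` and the hyperplane `z⊥`, although `x` is not orthogonal to `z`. This
is impossible (`IsLineSystem.inner_eq_zero`): projecting the line onto the hyperplane gives two
distinct verified lines. Any hyperplane through one is verified, so the projections of the other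
onto these are verified too; they sweep out a circle containing pairs at larger angles. Iterating
yields two orthogonal verified lines, whose Sasaki projection is `⊥`. -/

/-- A set `S` of vectors (the lines of a Sasaki-closed filter) and a set `R` of vectors (the
hyperplanes of that filter, given by normals) such that no two vectors of `S` are orthogonal and `S`
is closed under orthogonal projection onto the hyperplanes. -/
structure IsLineSystem (𝕜 : Type*) {H : Type*} [RCLike 𝕜] [NormedAddCommGroup H]
    [InnerProductSpace 𝕜 H] (S R : Set H) : Prop where
  inner_ne_zero : ∀ {v w : H}, v ∈ S → w ∈ S → ⟪v, w⟫_𝕜 ≠ 0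
  smul_mem : ∀ {v : H} {k : 𝕜}, v ∈ S → k ≠ 0 → k • v ∈ S
  normal_mem : ∀ {u v : H}, v ∈ S → ⟪u, v⟫_𝕜 = 0 → u ∈ R
  proj_mem : ∀ {u w : H} (k : 𝕜), u ∈ R → w + k • u ∈ S → ⟪u, w⟫_𝕜 = 0 → w ∈ S

/-! ### Angles between the lines of a line system -/

section Vectors

variable {𝕜 H : Type*} [RCLike 𝕜] [NormedAddCommGroup H] [InnerProductSpace 𝕜 H]

/-- The real inner product formula in an orthogonal frame `v, f, g` with `‖v‖ = 1` and
`‖f‖² = ‖g‖² = T`. -/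
theorem inner_frame {v f g : H} {T : ℝ} (hv : ⟪v, v⟫_𝕜 = 1) (hf : ⟪f, f⟫_𝕜 = (T : 𝕜))
    (hg : ⟪g, g⟫_𝕜 = (T : 𝕜)) (hvf : ⟪v, f⟫_𝕜 = 0) (hvg : ⟪v, g⟫_𝕜 = 0) (hfg : ⟪f, g⟫_𝕜 = 0)
    (a b a' b' : ℝ) :
    ⟪v + (a : 𝕜) • f + (b : 𝕜) • g, v + (a' : 𝕜) • f + (b' : 𝕜) • g⟫_𝕜 =
      ((1 + T * (a * a' + b * b') : ℝ) : 𝕜) := by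
  have hfv := inner_eq_zero_symm.mp hvf
  have hgv := inner_eq_zero_symm.mp hvg
  have hgf := inner_eq_zero_symm.mp hfg
  simp only [inner_add_left, inner_add_right, inner_smul_left, inner_smul_right, hv, hf, hg, hvf,
    hvg, hfg, hfv, hgv, hgf, RCLike.conj_ofReal]
  push_cast
  ring

/-- Dimension at least 3 enters here: it leaves room for a third direction in which to turn the
hyperplanes through `v`. -/
theorem exists_orthogonal_of_norm [FiniteDimensional 𝕜 H] (hdim : 3 ≤ Module.finrank 𝕜 H)
    (v f : H) (T : ℝ) (hT : 0 ≤ T) :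
    ∃ g : H, ⟪v, g⟫_𝕜 = 0 ∧ ⟪f, g⟫_𝕜 = 0 ∧ ⟪g, g⟫_𝕜 = (T : 𝕜) := by
  set K : Submodule 𝕜 H := Submodule.span 𝕜 {v, f}
  have hne : K ≠ ⊤ := by
    intro h
    have h1 : Module.finrank 𝕜 K ≤ 2 := by
      classical
      have h2 := finrank_span_finset_le_card (R := 𝕜) ({v, f} : Finset H)
      rw [Set.finrank, Finset.coe_pair] at h2
      exact h2.trans Finset.card_le_two
    rw [h, finrank_top] at h1
    omega
  have hbot : Kᗮ ≠ ⊥ := fun h => hne (Submodule.orthogonal_eq_bot_iff.mp h)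
  obtain ⟨g, hgK, hg0⟩ := Submodule.exists_mem_ne_zero_of_ne_bot hbot
  have hgn : ‖g‖ ≠ 0 := norm_ne_zero_iff.mpr hg0
  have key := (Submodule.mem_orthogonal K g).mp hgK
  have h1 := key v (Submodule.subset_span (by simp))
  have h2 := key f (Submodule.subset_span (by simp))
  refine ⟨((Real.sqrt T / ‖g‖ : ℝ) : 𝕜) • g, by simp [inner_smul_right, h1],
    by simp [inner_smul_right, h2], ?_⟩
  rw [inner_self_eq_norm_sq_to_K, norm_smul, RCLike.norm_ofReal, abs_of_nonneg (by positivity),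
    div_mul_cancel₀ _ hgn, ← RCLike.ofReal_pow, Real.sq_sqrt hT]

/-- `S` contains two lines whose angle `θ` satisfies `tan² θ = T`. -/
def HasAngle (𝕜 : Type*) {H : Type*} [RCLike 𝕜] [NormedAddCommGroup H] [InnerProductSpace 𝕜 H]
    (S : Set H) (T : ℝ) : Prop :=
  ∃ v w : H, v ∈ S ∧ w ∈ S ∧ ‖v‖ ^ 2 * ‖w‖ ^ 2 = (1 + T) * ‖⟪v, w⟫_𝕜‖ ^ 2

namespace IsLineSystem

variable {S R : Set H}

theorem ne_zero (h : IsLineSystem 𝕜 S R) {v : H} (hv : v ∈ S) : v ≠ 0 := by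
  rintro rfl
  exact h.inner_ne_zero hv hv (inner_zero_left _)

theorem exists_unit_add (h : IsLineSystem 𝕜 S R) {T : ℝ} (hT : HasAngle 𝕜 S T) :
    ∃ v f : H, ⟪v, v⟫_𝕜 = 1 ∧ ⟪v, f⟫_𝕜 = 0 ∧ ⟪f, f⟫_𝕜 = (T : 𝕜) ∧ v ∈ S ∧ v + f ∈ S := by
  obtain ⟨v, w, hv, hw, hvw⟩ := hT
  have hv0 : ‖v‖ ≠ 0 := norm_ne_zero_iff.mpr (h.ne_zero hv)
  have hi := h.inner_ne_zero hv hw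
  have hvK : ((‖v‖ : ℝ) : 𝕜) ≠ 0 := by exact_mod_cast hv0
  set v' : H := ((‖v‖ : ℝ) : 𝕜)⁻¹ • v with hv'
  set k : 𝕜 := ((‖v‖ : ℝ) : 𝕜) / ⟪v, w⟫_𝕜 with hk
  have hk0 : k ≠ 0 := div_ne_zero hvK hi
  have h1 : ⟪v', v'⟫_𝕜 = 1 := by
    rw [inner_self_eq_norm_sq_to_K, hv', norm_smul, norm_inv, RCLike.norm_ofReal, abs_norm,
      inv_mul_cancel₀ hv0]
    simp
  have h2 : ⟪v', k • w⟫_𝕜 = 1 := by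
    rw [hv', inner_smul_left, inner_smul_right, hk, map_inv₀, RCLike.conj_ofReal]
    field_simp
  have h3 : ⟪k • w, v'⟫_𝕜 = 1 := by rw [← inner_conj_symm, h2, map_one]
  have h4 : ⟪k • w, k • w⟫_𝕜 = ((1 + T : ℝ) : 𝕜) := by
    rw [inner_self_eq_norm_sq_to_K, ← RCLike.ofReal_pow, norm_smul, hk, norm_div,
      RCLike.norm_ofReal, abs_norm]
    congr 1
    have : ‖⟪v, w⟫_𝕜‖ ≠ 0 := norm_ne_zero_iff.mpr hi
    field_simp
    linarith
  refine ⟨v', k • w - v', h1, by rw [inner_sub_right, h1, h2, sub_self], ?_,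
    h.smul_mem hv (inv_ne_zero hvK), ?_⟩
  · rw [inner_sub_left, inner_sub_right, inner_sub_right, h1, h2, h3, h4]
    push_cast
    ring
  · rw [add_sub_cancel]
    exact h.smul_mem hw hk0

/-- The projections of the line through `v + f` onto the planes containing `v` form a circle. -/
theorem circle_mem (h : IsLineSystem 𝕜 S R) {v f g : H} {T : ℝ} (hf : ⟪f, f⟫_𝕜 = (T : 𝕜))
    (hg : ⟪g, g⟫_𝕜 = (T : 𝕜)) (hvf : ⟪v, f⟫_𝕜 = 0) (hvg : ⟪v, g⟫_𝕜 = 0) (hfg : ⟪f, g⟫_𝕜 = 0)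
    (hv : v ∈ S) (hvS : v + f ∈ S) {c s : ℝ} (hcs : c ^ 2 + s ^ 2 = 1) :
    v + ((c ^ 2 : ℝ) : 𝕜) • f + ((c * s : ℝ) : 𝕜) • g ∈ S := by
  have hfv := inner_eq_zero_symm.mp hvf
  have hgv := inner_eq_zero_symm.mp hvg
  have hgf := inner_eq_zero_symm.mp hfg
  -- The normal `u` is orthogonal to `v`; the target point is `v + f` with its `u`-component `-s •
  -- u` removed.
  set u : H := ((-s : ℝ) : 𝕜) • f + ((c : ℝ) : 𝕜) • g with hu
  have huR : u ∈ R := h.normal_mem hv (by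
    simp [hu, inner_add_left, inner_smul_left, hfv, hgv])
  refine h.proj_mem ((-s : ℝ) : 𝕜) huR ?_ ?_
  · convert hvS using 1
    have h1 : ((c ^ 2 : ℝ) : 𝕜) = 1 - ((s : ℝ) : 𝕜) ^ 2 := by
      rw [show c ^ 2 = 1 - s ^ 2 by linarith]; push_cast; ring
    rw [hu, h1]
    push_cast
    module
  · simp only [hu, inner_add_left, inner_add_right, inner_smul_left, inner_smul_right, hf, hg,
      hfg, hfv, hgv, hgf, RCLike.conj_ofReal]
    push_cast
    ring

theorem hasAngle_of_frame {v f g : H} {T : ℝ} (hv : ⟪v, v⟫_𝕜 = 1) (hf : ⟪f, f⟫_𝕜 = (T : 𝕜))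
    (hg : ⟪g, g⟫_𝕜 = (T : 𝕜)) (hvf : ⟪v, f⟫_𝕜 = 0) (hvg : ⟪v, g⟫_𝕜 = 0) (hfg : ⟪f, g⟫_𝕜 = 0)
    {a b a' b' T' : ℝ} (h1 : v + (a : 𝕜) • f + (b : 𝕜) • g ∈ S)
    (h2 : v + (a' : 𝕜) • f + (b' : 𝕜) • g ∈ S)
    (hT' : (1 + T * (a * a + b * b)) * (1 + T * (a' * a' + b' * b')) =
      (1 + T') * (1 + T * (a * a' + b * b')) ^ 2) : HasAngle 𝕜 S T' := by
  refine ⟨_, _, h1, h2, ?_⟩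
  rw [← inner_self_eq_norm_sq (𝕜 := 𝕜), ← inner_self_eq_norm_sq (𝕜 := 𝕜),
    inner_frame hv hf hg hvf hvg hfg, inner_frame hv hf hg hvf hvg hfg,
    inner_frame hv hf hg hvf hvg hfg, RCLike.ofReal_re, RCLike.ofReal_re, RCLike.norm_ofReal,
    sq_abs, hT']

variable [FiniteDimensional 𝕜 H]

/-- The circle passes through `v` itself (`c = 0`), and its point with parameter `c` makes an angle
with `v` of squared tangent `T * c ^ 2`. -/
theorem hasAngle_of_le (h : IsLineSystem 𝕜 S R) (hdim : 3 ≤ Module.finrank 𝕜 H) {T T' : ℝ}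
    (hT : HasAngle 𝕜 S T) (h0 : 0 < T') (hle : T' ≤ T) : HasAngle 𝕜 S T' := by
  obtain ⟨v, f, hv, hvf, hf, hvS, hvfS⟩ := h.exists_unit_add hT
  have hTpos : 0 < T := h0.trans_le hle
  obtain ⟨g, hvg, hfg, hg⟩ := exists_orthogonal_of_norm (𝕜 := 𝕜) hdim v f T hTpos.le
  have hle1 : T' / T ≤ 1 := (div_le_one hTpos).mpr hle
  have hc : Real.sqrt (T' / T) ^ 2 = T' / T := Real.sq_sqrt (by positivity)
  have hs : Real.sqrt (1 - T' / T) ^ 2 = 1 - T' / T := Real.sq_sqrt (by linarith)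
  set c := Real.sqrt (T' / T)
  set s := Real.sqrt (1 - T' / T)
  have h1 := h.circle_mem hf hg hvf hvg hfg hvS hvfS (c := 0) (s := 1) (by norm_num)
  have h2 := h.circle_mem hf hg hvf hvg hfg hvS hvfS (c := c) (s := s) (by rw [hc, hs]; ring)
  refine hasAngle_of_frame hv hf hg hvf hvg hfg h1 h2 ?_
  have : c ^ 2 * c ^ 2 + c * s * (c * s) = T' / T := by
    calc c ^ 2 * c ^ 2 + c * s * (c * s) = c ^ 2 * (c ^ 2 + s ^ 2) := by ring
      _ = T' / T := by rw [hc, hs]; ring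
  rw [this, mul_div_cancel₀ _ hTpos.ne']
  ring

/-- The points `v + f/2 ± g/2` are the ends of a diameter: their inner product is 1 and each has
squared norm `1 + T/2`. -/
theorem hasAngle_add (h : IsLineSystem 𝕜 S R) (hdim : 3 ≤ Module.finrank 𝕜 H) {T : ℝ}
    (hT : HasAngle 𝕜 S T) (h0 : 0 ≤ T) : HasAngle 𝕜 S (T + T ^ 2 / 4) := by
  obtain ⟨v, f, hv, hvf, hf, hvS, hvfS⟩ := h.exists_unit_add hT
  obtain ⟨g, hvg, hfg, hg⟩ := exists_orthogonal_of_norm (𝕜 := 𝕜) hdim v f T h0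
  have hc : Real.sqrt (1 / 2) ^ 2 = 1 / 2 := Real.sq_sqrt (by norm_num)
  set c := Real.sqrt (1 / 2)
  have h1 := h.circle_mem hf hg hvf hvg hfg hvS hvfS (c := c) (s := c) (by rw [hc]; norm_num)
  have h2 := h.circle_mem hf hg hvf hvg hfg hvS hvfS (c := c) (s := -c)
    (by rw [neg_sq, hc]; norm_num)
  refine hasAngle_of_frame hv hf hg hvf hvg hfg h1 h2 ?_
  have hcc : c * c = 1 / 2 := by rw [← hc]; ring
  rw [mul_neg, hcc, hc]
  ring

/-- The least value of `1 + T * (c ^ 4 - c ^ 2 * s ^ 2)` is `1 - T/8`, attained at `c = 1/2`; at `T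
= 8` the mirror pair is orthogonal. -/
theorem not_hasAngle_eight (h : IsLineSystem 𝕜 S R) (hdim : 3 ≤ Module.finrank 𝕜 H) :
    ¬ HasAngle 𝕜 S 8 := by
  intro hT
  obtain ⟨v, f, hv, hvf, hf, hvS, hvfS⟩ := h.exists_unit_add hT
  obtain ⟨g, hvg, hfg, hg⟩ := exists_orthogonal_of_norm (𝕜 := 𝕜) hdim v f 8 (by norm_num)
  have hs : Real.sqrt (3 / 4) ^ 2 = 3 / 4 := Real.sq_sqrt (by norm_num)
  set s := Real.sqrt (3 / 4)
  have h1 := h.circle_mem hf hg hvf hvg hfg hvS hvfS (c := 1 / 2) (s := s)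
    (by rw [hs]; norm_num)
  have h2 := h.circle_mem hf hg hvf hvg hfg hvS hvfS (c := 1 / 2) (s := -s)
    (by rw [neg_sq, hs]; norm_num)
  refine h.inner_ne_zero h1 h2 ?_
  rw [inner_frame hv hf hg hvf hvg hfg]
  have : (1 : ℝ) + 8 * ((1 / 2) ^ 2 * (1 / 2) ^ 2 + 1 / 2 * s * (1 / 2 * -s)) = 0 := by
    linear_combination (-2) * hs
  rw [this, RCLike.ofReal_zero]

theorem not_hasAngle (h : IsLineSystem 𝕜 S R) (hdim : 3 ≤ Module.finrank 𝕜 H) {T : ℝ}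
    (h0 : 0 < T) : ¬ HasAngle 𝕜 S T := by
  intro hT
  have key : ∀ n : ℕ, HasAngle 𝕜 S (T + n * (T ^ 2 / 4)) := by
    intro n
    induction n with
    | zero => simpa using hT
    | succ n ih =>
      have hle : T ≤ T + n * (T ^ 2 / 4) := le_add_of_nonneg_right (by positivity)
      -- The gain is at least `T ^ 2 / 4` since the current value is at least `T`; the excess is
      -- then trimmed.
      refine h.hasAngle_of_le hdim (h.hasAngle_add hdim ih (h0.le.trans hle)) (by positivity) ?_
      have := pow_le_pow_left₀ h0.le hle 2
      push_cast
      linarith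
  obtain ⟨n, hn⟩ := exists_nat_ge (8 / (T ^ 2 / 4))
  rw [div_le_iff₀ (by positivity)] at hn
  exact h.not_hasAngle_eight hdim
    (h.hasAngle_of_le hdim (key n) (by norm_num) (by linarith))

/-- Every line of a line system is contained in each of its hyperplanes. -/
theorem inner_eq_zero (h : IsLineSystem 𝕜 S R) (hdim : 3 ≤ Module.finrank 𝕜 H) {x z : H}
    (hx : x ∈ S) (hz : z ∈ R) : ⟪z, x⟫_𝕜 = 0 := by
  by_contra hzx
  have hz0 : ⟪z, z⟫_𝕜 ≠ 0 := by
    rw [inner_self_ne_zero]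
    rintro rfl
    exact hzx (inner_zero_left _)
  set k : 𝕜 := ⟪z, x⟫_𝕜 / ⟪z, z⟫_𝕜 with hk
  set w : H := x - k • z with hw
  have hzw : ⟪z, w⟫_𝕜 = 0 := by
    rw [hw, inner_sub_right, inner_smul_right, hk, div_mul_cancel₀ _ hz0, sub_self]
  have hxw : x = w + k • z := by rw [hw, sub_add_cancel]
  have hwS : w ∈ S := h.proj_mem k hz (hxw ▸ hx) hzw
  have hw0 : ‖w‖ ≠ 0 := norm_ne_zero_iff.mpr (h.ne_zero hwS)
  have hkz : ‖k • z‖ ≠ 0 :=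
    norm_ne_zero_iff.mpr (smul_ne_zero (div_ne_zero hzx hz0) (inner_self_ne_zero.mp hz0))
  have hwk : ⟪w, k • z⟫_𝕜 = 0 := by
    rw [inner_smul_right, inner_eq_zero_symm.mp hzw, mul_zero]
  refine h.not_hasAngle hdim (T := ‖k • z‖ ^ 2 / ‖w‖ ^ 2) (by positivity) ⟨w, x, hwS, hx, ?_⟩
  have h1 : ⟪w, x⟫_𝕜 = ((‖w‖ ^ 2 : ℝ) : 𝕜) := by
    rw [hxw, inner_add_right, hwk, add_zero, inner_self_eq_norm_sq_to_K, RCLike.ofReal_pow]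
  have h2 : ‖x‖ ^ 2 = ‖w‖ ^ 2 + ‖k • z‖ ^ 2 := by
    rw [hxw, sq, sq, sq]
    exact norm_add_sq_eq_norm_sq_add_norm_sq_of_inner_eq_zero w (k • z) hwk
  rw [h1, h2, RCLike.norm_ofReal, abs_of_nonneg (by positivity)]
  field_simp

end IsLineSystem

end Vectors

/-! ### Verified properties as Sasaki-closed filters -/

section Filters

variable {𝕜 H : Type*} [RCLike 𝕜] [NormedAddCommGroup H] [InnerProductSpace 𝕜 H] [CompleteSpace H]

theorem mem_ortho {p : ClosedSubmodule 𝕜 H} {x : H} :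
    x ∈ Orthomodular.ortho p ↔ ∀ u ∈ p, ⟪u, x⟫_𝕜 = 0 :=
  Submodule.mem_orthogonal p.toSubmodule x

/-- A Sasaki-closed proper filter of closed subspaces. -/
structure IsSasakiFilter (F : Set (ClosedSubmodule 𝕜 H)) : Prop where
  bot_notMem : ⊥ ∉ F
  mem_of_le : ∀ {p q}, p ≤ q → p ∈ F → q ∈ F
  sasaki_mem : ∀ {p q}, p ∈ F → q ∈ F → sasaki p q ∈ F

variable {A : Type*} {G : MeasurementGraph (ClosedSubmodule 𝕜 H) A}

theorem MeasurementGraph.IsModel.isSasakiFilter (hG : G.IsModel) (a : A) :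
    IsSasakiFilter (G.verified a) where
  bot_notMem := hG.not_verifies_bot a
  mem_of_le hpq hp := hG.verifies_of_le _ _ hpq a hp
  sasaki_mem hp hq := hG.verifies_sasaki _ _ a hp hq

/-- If the outcome `q` is possible at `a`, it leads to a system verifying `p & q` for every `p`
verified by `a`. -/
theorem MeasurementGraph.IsModel.exists_outcome (hG : G.IsModel) {a : A}
    {q : ClosedSubmodule 𝕜 H} (hq : ¬ G.Verifies a (Orthomodular.ortho q)) :
    ∃ b, ∀ p, G.Verifies a p → G.Verifies b (sasaki p q) := by
  obtain ⟨b, hb⟩ := not_not.mp hq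
  rw [Orthomodular.ortho_ortho] at hb
  exact ⟨b, fun p hp => hG.compatible_preservation p q a b hp hb⟩

end Filters

/-! ### Lines and hyperplanes in the lattice; minimal verified properties -/

section Lattice

variable {𝕜 H : Type*} [RCLike 𝕜] [NormedAddCommGroup H] [InnerProductSpace 𝕜 H]
  [FiniteDimensional 𝕜 H]

/-- A subspace of a finite-dimensional space as a closed subspace. -/
def closedOf (K : Submodule 𝕜 H) : ClosedSubmodule 𝕜 H :=
  ⟨K, K.closed_of_finiteDimensional⟩

/-- The line through `v`. -/
def line (𝕜 : Type*) {H : Type*} [RCLike 𝕜] [NormedAddCommGroup H] [InnerProductSpace 𝕜 H]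
    [FiniteDimensional 𝕜 H] (v : H) : ClosedSubmodule 𝕜 H := closedOf (Submodule.span 𝕜 {v})

theorem mem_line {v x : H} : x ∈ line 𝕜 v ↔ ∃ k : 𝕜, k • v = x := Submodule.mem_span_singleton

theorem line_le {v : H} {p : ClosedSubmodule 𝕜 H} : line 𝕜 v ≤ p ↔ v ∈ p :=
  Submodule.span_singleton_le_iff_mem v p.toSubmodule

/-- The hyperplane with normal `u`. -/
def hyperplane (𝕜 : Type*) {H : Type*} [RCLike 𝕜] [NormedAddCommGroup H] [InnerProductSpace 𝕜 H]
    [FiniteDimensional 𝕜 H] (u : H) : ClosedSubmodule 𝕜 H := (line 𝕜 u).orthogonal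

theorem mem_hyperplane {u x : H} : x ∈ hyperplane 𝕜 u ↔ ⟪u, x⟫_𝕜 = 0 :=
  Submodule.mem_orthogonal_singleton_iff_inner_right

theorem exists_minimal_closedSubmodule {P : ClosedSubmodule 𝕜 H → Prop}
    (hP : ∃ p, P p) : ∃ p, Minimal P p := by
  have hwf : WellFounded ((· < ·) : ClosedSubmodule 𝕜 H → ClosedSubmodule 𝕜 H → Prop) :=
    Subrelation.wf (r := InvImage (· < ·) fun p : ClosedSubmodule 𝕜 H => p.toSubmodule)
      (fun {p q} h => h) (InvImage.wf _ wellFounded_lt)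
  obtain ⟨p, hp, hmin⟩ := hwf.has_min {p | P p} hP
  exact ⟨p, hp, fun q hq hle => (eq_or_lt_of_le hle).elim (fun h => h.ge)
    (fun h => (hmin q hq h).elim)⟩

variable [CompleteSpace H]

theorem ortho_hyperplane (u : H) : Orthomodular.ortho (hyperplane 𝕜 u) = line 𝕜 u :=
  Orthomodular.ortho_ortho (line 𝕜 u)

theorem sasaki_le_hyperplane {p q : ClosedSubmodule 𝕜 H} {u : H} (hu : u ∈ q)
    (hp : ∀ x ∈ p, ⟪u, x⟫_𝕜 = 0) : sasaki p q ≤ hyperplane 𝕜 u :=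
  inf_le_right.trans (sup_le (fun x hx => mem_hyperplane.mpr (hp x hx))
    (fun _ hx => mem_hyperplane.mpr (mem_ortho.mp hx u hu)))

theorem sasaki_line_hyperplane_le {u w : H} (k : 𝕜) (huw : ⟪u, w⟫_𝕜 = 0) :
    sasaki (line 𝕜 (w + k • u)) (hyperplane 𝕜 u) ≤ line 𝕜 w := by
  intro x hx
  have hx1 : ⟪u, x⟫_𝕜 = 0 := mem_hyperplane.mp hx.1
  have hle : line 𝕜 (w + k • u) ⊔ Orthomodular.ortho (hyperplane 𝕜 u) ≤
      closedOf (Submodule.span 𝕜 {w, u}) := by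
    rw [ortho_hyperplane]
    refine sup_le (line_le.mpr ?_) (line_le.mpr ?_)
    · exact Submodule.mem_span_pair.mpr ⟨1, k, by simp⟩
    · exact Submodule.mem_span_pair.mpr ⟨0, 1, by simp⟩
  obtain ⟨a, b, rfl⟩ := Submodule.mem_span_pair.mp (hle hx.2)
  rw [inner_add_right, inner_smul_right, inner_smul_right, huw, mul_zero, zero_add,
    mul_eq_zero, inner_self_eq_zero] at hx1
  refine mem_line.mpr ⟨a, ?_⟩
  rcases hx1 with rfl | rfl <;> simp

namespace IsSasakiFilter

variable {F : Set (ClosedSubmodule 𝕜 H)}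

theorem isLineSystem (h : IsSasakiFilter F) :
    IsLineSystem 𝕜 {v | line 𝕜 v ∈ F} {u | hyperplane 𝕜 u ∈ F} where
  inner_ne_zero {v w} hv hw hvw := by
    refine h.bot_notMem (h.mem_of_le ?_ (h.sasaki_mem hv hw))
    intro x hx
    have h1 : ⟪w, x⟫_𝕜 = 0 := by
      refine mem_hyperplane.mp (sasaki_le_hyperplane (line_le.mp le_rfl) ?_ hx)
      intro y hy
      obtain ⟨k, rfl⟩ := mem_line.mp hy
      rw [inner_smul_right, inner_eq_zero_symm.mp hvw, mul_zero]
    obtain ⟨k, rfl⟩ := mem_line.mp hx.1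
    rw [inner_smul_right, mul_eq_zero, inner_self_eq_zero] at h1
    rcases h1 with rfl | rfl <;> simp
  smul_mem {v k} hv hk :=
    h.mem_of_le (line_le.mpr (mem_line.mpr ⟨k⁻¹, by rw [smul_smul, inv_mul_cancel₀ hk, one_smul]⟩))
      hv
  normal_mem hv huv := h.mem_of_le (line_le.mpr (mem_hyperplane.mpr huv)) hv
  proj_mem k hu hw huw := h.mem_of_le (sasaki_line_hyperplane_le k huw) (h.sasaki_mem hw hu)

end IsSasakiFilter

variable {A : Type*} {G : MeasurementGraph (ClosedSubmodule 𝕜 H) A}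

/-- A minimal verified property is the least one. -/
theorem MeasurementGraph.IsModel.le_of_minimal (hG : G.IsModel)
    (hdim : 3 ≤ Module.finrank 𝕜 H) {a : A} {p r : ClosedSubmodule 𝕜 H}
    (hp : Minimal (G.Verifies a) p) (hr : G.Verifies a r) : p ≤ r := by
  by_contra hpr
  obtain ⟨z, hzr, hzp⟩ : ∃ z ∈ Orthomodular.ortho r, z ∉ Orthomodular.ortho p := by
    by_contra! hcon
    refine hpr ?_
    rw [← Orthomodular.ortho_ortho p, ← Orthomodular.ortho_ortho r]
    exact Orthomodular.ortho_le_ortho _ _ hcon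
  obtain ⟨x, hxp, y, hyp, rfl⟩ := p.toSubmodule.exists_add_mem_mem_orthogonal z
  have hx0 : x ≠ 0 := by
    rintro rfl
    rw [zero_add] at hzp
    exact hzp hyp
  have hyx : ⟪y, x⟫_𝕜 = 0 := Submodule.inner_left_of_mem_orthogonal hxp hyp
  set q : ClosedSubmodule 𝕜 H := closedOf (Submodule.span 𝕜 {x, y})
  have hxq : x ∈ q := Submodule.subset_span (by simp)
  have hyq : y ∈ q := Submodule.subset_span (by simp)
  -- Otherwise `sasaki (ortho q) p` would be verified and lie below `p`, hence equal `p` by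
  -- minimality, yet it is orthogonal to `x ∈ p`.
  have hqa : ¬ G.Verifies a (Orthomodular.ortho q) := by
    intro hv
    have hs := hG.verifies_sasaki _ _ a hv hp.1
    have hxs : x ∈ sasaki (Orthomodular.ortho q) p := hp.2 hs inf_le_left hxp
    refine hx0 (inner_self_eq_zero (𝕜 := 𝕜).mp (mem_hyperplane.mp
      (sasaki_le_hyperplane hxp (fun u hu => mem_ortho.mp hu x hxq) hxs)))
  obtain ⟨b, hb⟩ := hG.exists_outcome hqa
  have hxb : line 𝕜 x ∈ G.verified b := by
    refine hG.verifies_of_le _ _ ?_ b (hb p hp.1)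
    intro w hw
    have hyw : ⟪y, w⟫_𝕜 = 0 := mem_hyperplane.mp (sasaki_le_hyperplane hyq
      (fun u hu => Submodule.inner_left_of_mem_orthogonal hu hyp) hw)
    obtain ⟨c, d, rfl⟩ := Submodule.mem_span_pair.mp hw.1
    rw [inner_add_right, inner_smul_right, inner_smul_right, hyx, mul_zero, zero_add,
      mul_eq_zero, inner_self_eq_zero] at hyw
    refine mem_line.mpr ⟨c, ?_⟩
    rcases hyw with rfl | rfl <;> simp
  have hzb : hyperplane 𝕜 (x + y) ∈ G.verified b := by
    refine hG.verifies_of_le _ _ (sasaki_le_hyperplane (add_mem hxq hyq) ?_) b (hb r hr)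
    intro u hu
    exact inner_eq_zero_symm.mp (mem_ortho.mp hzr u hu)
  have h0 := (hG.isSasakiFilter b).isLineSystem.inner_eq_zero hdim hxb hzb
  rw [inner_add_left, hyx, add_zero, inner_self_eq_zero] at h0
  exact hx0 h0

theorem MeasurementGraph.IsModel.exists_isLeast (hG : G.IsModel)
    (hdim : 3 ≤ Module.finrank 𝕜 H) (a : A) : ∃ p, IsLeast (G.verified a) p := by
  obtain ⟨p, hp⟩ := exists_minimal_closedSubmodule ⟨⊤, hG.verifies_top a⟩
  exact ⟨p, hp.1, fun _ hr => hG.le_of_minimal hdim hp hr⟩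

end Lattice

end QuantumMeasurement

theorem mainTheorem2 {𝕜 : Type*} [RCLike 𝕜] {H : Type*} [NormedAddCommGroup H]
    [InnerProductSpace 𝕜 H] [CompleteSpace H] [FiniteDimensional 𝕜 H]
    (hdim : 3 ≤ Module.finrank 𝕜 H) {A : Type*}
    (G : QuantumMeasurement.MeasurementGraph (ClosedSubmodule 𝕜 H) A) (hG : G.IsModel) :
    (∃ e : A → ClosedSubmodule 𝕜 H,
      ∀ a, IsLeast (G.verified a) (e a) ∧ G.verified a = {p | e a ≤ p}) ∧
    (∀ (p q : ClosedSubmodule 𝕜 H) (a : A),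
      G.Verifies a p → G.Verifies a q → G.Verifies a (p ⊓ q)) := by
  choose e he using hG.exists_isLeast hdim
  have hmem : ∀ a p, G.Verifies a p ↔ e a ≤ p := fun a p =>
    ⟨fun hp => (he a).2 hp, fun hp => hG.verifies_of_le _ _ hp a (he a).1⟩
  refine ⟨⟨e, fun a => ⟨he a, Set.ext (hmem a)⟩⟩, fun p q a hp hq => ?_⟩
  rw [hmem] at hp hq ⊢
  exact le_inf hp hq
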